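/- Let $M$ and $P$ be connected paracompact (Hausdorff) smooth manifolds, let $G$ be a Lie group, and let $p : P \to M$ be a smooth principal fibre bundle with structure group $G$ acting smoothly from the left on $P$. Let $\omega$ be a flat connection on this bundle. Fix $x_0 \in P$ and let $h_\omega : \pi_1(M, p(x_0)) \to G$ be its holonomy homomorphism: for a loop $w$ at $p(x_0)$, the horizontal lift of $w$ starting at $x_0$ ends at $h_\omega([w])\, x_0$. Let $q : \widehat M \to M$ be a connected smooth covering manifold of $M$ and let $\widehat m_0 \in \widehat M$ be a point with $q(\widehat m_0) = p(x_0)$, such that $q_\#\,\pi_1(\widehat M, \widehat m_0) = \ker h_\omega$. Let $\widehat P = \{(\widehat m, x) \in \widehat M \times P : q(\widehat m) = p(x)\}$ be the total space of the bundle over $\widehat M$ induced by $q$, let $\widehat q : \widehat P \to P$, $(\widehat m, x) \mapsto x$, and let $\widehat x_0 = (\widehat m_0, x_0)$. Then $\widehat q_\# : \pi_1(\widehat P, \widehat x_0) \to \pi_1(P, x_0)$ is injective and its image is $p_\#^{-1}(\ker h_\omega)$. In particular it induces an isomorphism $$\pi_1(\widehat P, \widehat x_0) \;\cong\; p_\#^{-1}(\ker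 h_\omega) \subseteq \pi_1(P, x_0).$$ -/

import Mathlib

open Set Filter Topology
open scoped Manifold ContDiff

namespace FlatBundle

noncomputable section

variable {EG EM EP : Type*}
  [NormedAddCommGroup EG] [NormedSpace ℝ EG]
  [NormedAddCommGroup EM] [NormedSpace ℝ EM]
  [NormedAddCommGroup EP] [NormedSpace ℝ EP]
  {G M P : Type*} [Group G] [TopologicalSpace G] [ChartedSpace EG G]
  [TopologicalSpace M] [ChartedSpace EM M]
  [TopologicalSpace P] [ChartedSpace EP P] [MulAction G P]

/-- `p : P → M` is a smooth principal fibre bundle whose structure group, the Lie group `G`, acts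
smoothly from the left on `P`: every point of `M` has an open neighbourhood `U` with a smooth
`G`-equivariant identification `p ⁻¹ U ≅ U × G` over `U`, where `G` acts on itself by left
multiplication. -/
structure IsSmoothPrincipalBundle (EG EM EP : Type*)
    [NormedAddCommGroup EG] [NormedSpace ℝ EG]
    [NormedAddCommGroup EM] [NormedSpace ℝ EM]
    [NormedAddCommGroup EP] [NormedSpace ℝ EP]
    (G : Type*) {M P : Type*} [Group G] [TopologicalSpace G] [ChartedSpace EG G]
    [TopologicalSpace M] [ChartedSpace EM M]
    [TopologicalSpace P] [ChartedSpace EP P] [MulAction G P] (p : P → M) : Prop where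
  contMDiff_smul : ContMDiff (𝓘(ℝ, EG).prod 𝓘(ℝ, EP)) 𝓘(ℝ, EP) ∞ (fun z : G × P ↦ z.1 • z.2)
  contMDiff_proj : ContMDiff 𝓘(ℝ, EP) 𝓘(ℝ, EM) ∞ p
  locallyTrivial : ∀ m : M, ∃ (U : Set M) (Φ : OpenPartialHomeomorph P (M × G)),
    IsOpen U ∧ m ∈ U ∧ Φ.source = p ⁻¹' U ∧ Φ.target = U ×ˢ univ ∧
    ContMDiffOn 𝓘(ℝ, EP) (𝓘(ℝ, EM).prod 𝓘(ℝ, EG)) ∞ Φ Φ.source ∧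
    ContMDiffOn (𝓘(ℝ, EM).prod 𝓘(ℝ, EG)) 𝓘(ℝ, EP) ∞ Φ.symm Φ.target ∧
    ∀ u ∈ Φ.source, (Φ u).1 = p u ∧
      ∀ g : G, p (g • u) = p u ∧ Φ (g • u) = (p u, g * (Φ u).2)

/-- The adjoint representation: the derivative at `1` of `x ↦ g * x * g⁻¹`. -/
def Ad (EG : Type*) [NormedAddCommGroup EG] [NormedSpace ℝ EG]
    {G : Type*} [Group G] [TopologicalSpace G] [ChartedSpace EG G] (g : G) :
    GroupLieAlgebra 𝓘(ℝ, EG) G →L[ℝ] GroupLieAlgebra 𝓘(ℝ, EG) G :=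
  (mfderiv 𝓘(ℝ, EG) 𝓘(ℝ, EG) (fun x : G ↦ g * x * g⁻¹) (1 : G) :
    TangentSpace 𝓘(ℝ, EG) (1 : G) →L[ℝ] TangentSpace 𝓘(ℝ, EG) (g * 1 * g⁻¹))

/-- A connection form for the left action of `G` on `P`: a smooth 1-form on `P` with values in the
Lie algebra of `G` that reproduces the generators of the fundamental vector fields and is
equivariant with respect to the adjoint representation. -/
structure ConnectionForm (EG EP : Type*)
    [NormedAddCommGroup EG] [NormedSpace ℝ EG]
    [NormedAddCommGroup EP] [NormedSpace ℝ EP]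
    (G P : Type*) [Group G] [TopologicalSpace G] [ChartedSpace EG G]
    [TopologicalSpace P] [ChartedSpace EP P] [IsManifold 𝓘(ℝ, EP) 1 P] [MulAction G P] where
  form : ∀ u : P, TangentSpace 𝓘(ℝ, EP) u →L[ℝ] GroupLieAlgebra 𝓘(ℝ, EG) G
  contMDiff_form : ContMDiff (M' := EG) 𝓘(ℝ, EP).tangent 𝓘(ℝ, EG) ∞
    (fun v : TangentBundle 𝓘(ℝ, EP) P ↦ form v.proj v.snd)
  form_fundamental : ∀ (u : P) (A : GroupLieAlgebra 𝓘(ℝ, EG) G),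
    form ((1 : G) • u) (mfderiv 𝓘(ℝ, EG) 𝓘(ℝ, EP) (fun g : G ↦ g • u) (1 : G) A) = A
  form_equivariant : ∀ (g : G) (u : P) (v : TangentSpace 𝓘(ℝ, EP) u),
    form (g • u) (mfderiv 𝓘(ℝ, EP) 𝓘(ℝ, EP) (fun x : P ↦ g • x) u v) = Ad EG g (form u v)

variable [IsManifold 𝓘(ℝ, EP) 1 P]

/-- `s` is a smooth section of `p` over the open set `U`, and its image is horizontal: all its
tangent vectors are annihilated by the connection form. -/
structure IsHorizontalSection (EM : Type*) [NormedAddCommGroup EM] [NormedSpace ℝ EM]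
    {M : Type*} [TopologicalSpace M] [ChartedSpace EM M]
    (θ : ConnectionForm EG EP G P) (p : P → M) (s : M → P) (U : Set M) : Prop where
  isOpen : IsOpen U
  contMDiffOn : ContMDiffOn 𝓘(ℝ, EM) 𝓘(ℝ, EP) ∞ s U
  proj : ∀ x ∈ U, p (s x) = x
  horizontal : ∀ x ∈ U, ∀ v : TangentSpace 𝓘(ℝ, EM) x,
    θ.form (s x) (mfderiv 𝓘(ℝ, EM) 𝓘(ℝ, EP) s x v) = 0

/-- The connection is flat: every point of `M` has an open neighbourhood `U` over which the bundle
with its connection is isomorphic to `U × G` with the canonical flat connection (whose horizontal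
spaces are the tangent spaces of the slices `U × {g}`). Such an isomorphism is
`(x, g) ↦ g • s x` for a horizontal section `s` over `U`. -/
def ConnectionForm.IsFlat (EM : Type*) [NormedAddCommGroup EM] [NormedSpace ℝ EM]
    {M : Type*} [TopologicalSpace M] [ChartedSpace EM M]
    (θ : ConnectionForm EG EP G P) (p : P → M) : Prop :=
  ∀ m : M, ∃ (U : Set M) (s : M → P), m ∈ U ∧ IsHorizontalSection EM θ p s U

/-- A (continuous) path in `P` is horizontal if locally it runs in a horizontal sheet, the
image of a horizontal section; that is, it is a path in a leaf of the horizontal foliation.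
(Curves with horizontal velocities have this property, see `isHorizontalPath_of_velocity`.) -/
def IsHorizontalPath (EM : Type*) [NormedAddCommGroup EM] [NormedSpace ℝ EM]
    {M : Type*} [TopologicalSpace M] [ChartedSpace EM M]
    (θ : ConnectionForm EG EP G P) (p : P → M) (c : C(unitInterval, P)) : Prop :=
  ∀ t : unitInterval, ∃ (U : Set M) (s : M → P), IsHorizontalSection EM θ p s U ∧ p (c t) ∈ U ∧
    ∀ᶠ t' in 𝓝 t, c t' = s (p (c t'))

/-- `c` is the horizontal lift, starting at `x₀`, of the path `w` of `M`. -/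
structure IsHorizontalLift (EM : Type*) [NormedAddCommGroup EM] [NormedSpace ℝ EM]
    {M : Type*} [TopologicalSpace M] [ChartedSpace EM M]
    (θ : ConnectionForm EG EP G P) (p : P → M) (x₀ : P) (w : C(unitInterval, M)) (c : C(unitInterval, P)) : Prop where
  isHorizontalPath : IsHorizontalPath EM θ p c
  proj : ∀ t, p (c t) = w t
  source : c 0 = x₀

end

section

theorem eventually_eq_of_mfderiv_eq_zero {E F N G : Type*}
    [NormedAddCommGroup E] [NormedSpace ℝ E] [NormedAddCommGroup F] [NormedSpace ℝ F]
    [TopologicalSpace N] [ChartedSpace E N] [IsManifold 𝓘(ℝ, E) 1 N]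
    [TopologicalSpace G] [ChartedSpace F G] [IsManifold 𝓘(ℝ, F) 1 G] {f : N → G} {y : N}
    (hf : ∀ᶠ z in 𝓝 y, MDifferentiableAt 𝓘(ℝ, E) 𝓘(ℝ, F) f z ∧
      mfderiv 𝓘(ℝ, E) 𝓘(ℝ, F) f z = 0) :
    ∀ᶠ z in 𝓝 y, f z = f y := by
  set φ := extChartAt 𝓘(ℝ, E) y with hφ
  set ψ := extChartAt 𝓘(ℝ, F) (f y) with hψ
  have hc : ContinuousAt f y := hf.self_of_nhds.1.continuousAt
  have h1 : ∀ᶠ z in 𝓝 y, (MDifferentiableAt 𝓘(ℝ, E) 𝓘(ℝ, F) f z ∧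
      mfderiv 𝓘(ℝ, E) 𝓘(ℝ, F) f z = 0) ∧ f z ∈ ψ.source ∧ z ∈ φ.source :=
    hf.and (Filter.Eventually.and (hc.preimage_mem_nhds (extChartAt_source_mem_nhds _))
      (extChartAt_source_mem_nhds _))
  have hy : φ.symm (φ y) = y := extChartAt_to_inv y
  have hcs : ContinuousAt φ.symm (φ y) := continuousAt_extChartAt_symm y
  have h2 : ∀ᶠ e in 𝓝 (φ y), e ∈ φ.target ∧ ((MDifferentiableAt 𝓘(ℝ, E) 𝓘(ℝ, F) f (φ.symm e) ∧
      mfderiv 𝓘(ℝ, E) 𝓘(ℝ, F) f (φ.symm e) = 0) ∧ f (φ.symm e) ∈ ψ.source ∧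
      φ.symm e ∈ φ.source) := by
    refine Filter.Eventually.and (extChartAt_target_mem_nhds (I := 𝓘(ℝ, E)) y) ?_
    have : Tendsto φ.symm (𝓝 (φ y)) (𝓝 y) := by simpa [ContinuousAt, hy] using hcs
    exact this.eventually h1
  obtain ⟨r, hr, hball⟩ := Metric.eventually_nhds_iff_ball.1 h2
  let k : E → F := fun e ↦ ψ (f (φ.symm e))
  have hk : ∀ e ∈ Metric.ball (φ y) r, DifferentiableAt ℝ k e ∧ fderiv ℝ k e = 0 := by
    intro e he
    obtain ⟨het, ⟨hd, h0⟩, hs, hs'⟩ := hball e he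
    have d1 : MDifferentiableAt 𝓘(ℝ, E) 𝓘(ℝ, E) φ.symm e :=
      ((contMDiffOn_extChartAt_symm (n := 1) y).contMDiffAt
        ((isOpen_extChartAt_target y).mem_nhds het)).mdifferentiableAt one_ne_zero
    have d3 : MDifferentiableAt 𝓘(ℝ, F) 𝓘(ℝ, F) ψ (f (φ.symm e)) :=
      mdifferentiableAt_extChartAt (by simpa [hψ] using hs)
    have H := (d3.hasMFDerivAt.comp (φ.symm e) hd.hasMFDerivAt).comp e d1.hasMFDerivAt
    rw [h0] at H
    have H' : HasFDerivAt k (0 : E →L[ℝ] F) e := by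
      refine (H.hasFDerivAt : HasFDerivAt k _ e).congr_fderiv ?_
      let L := mfderiv 𝓘(ℝ, F) 𝓘(ℝ, F) ψ (f (φ.symm e))
      refine @ContinuousLinearMap.ext ℝ ℝ _ _ _ E _ _ F _ _ _ _ _ _ fun v ↦ ?_
      exact L.map_zero
    exact ⟨H'.differentiableAt, H'.fderiv⟩
  have hconst := fun e he ↦ Metric.isOpen_ball.is_const_of_fderiv_eq_zero
    (convex_ball (φ y) r).isPreconnected
    (fun e he ↦ (hk e he).1.differentiableWithinAt) (fun e he ↦ (hk e he).2)
    (x := e) he (Metric.mem_ball_self hr)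
  have hφc : ContinuousAt φ y := continuousAt_extChartAt y
  filter_upwards [h1, hφc.preimage_mem_nhds (Metric.ball_mem_nhds (φ y) hr)] with z hz hzb
  have := hconst _ hzb
  simp only [k, hy, φ.left_inv hz.2.2] at this
  exact ψ.injOn hz.2.1 (mem_extChartAt_source _) this


variable {EG EM EP : Type*}
  [NormedAddCommGroup EG] [NormedSpace ℝ EG]
  [NormedAddCommGroup EM] [NormedSpace ℝ EM]
  [NormedAddCommGroup EP] [NormedSpace ℝ EP]
  {G M P : Type*} [Group G] [TopologicalSpace G] [ChartedSpace EG G]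
  [TopologicalSpace M] [ChartedSpace EM M]
  [TopologicalSpace P] [ChartedSpace EP P] [MulAction G P] {p : P → M}

theorem IsSmoothPrincipalBundle.proj_smul (hp : IsSmoothPrincipalBundle EG EM EP G p)
    (g : G) (u : P) : p (g • u) = p u := by
  obtain ⟨U, Φ, -, hm, hs, -, -, -, h⟩ := hp.locallyTrivial (p u)
  exact ((h u (by rw [hs]; exact hm)).2 g).1

theorem IsSmoothPrincipalBundle.existsUnique_smul_eq
    (hp : IsSmoothPrincipalBundle EG EM EP G p) {u u' : P} (hu : p u' = p u) :
    ∃! g : G, g • u = u' := by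
  obtain ⟨U, Φ, -, hm, hs, -, -, -, h⟩ := hp.locallyTrivial (p u)
  have hu1 : u ∈ Φ.source := by rw [hs]; exact hm
  have hu2 : u' ∈ Φ.source := by rw [hs]; change p u' ∈ U; rwa [hu]
  have hg : ∀ g : G, g • u ∈ Φ.source := fun g ↦ by
    rw [hs]; change p (g • u) ∈ U; rwa [hp.proj_smul]
  refine ⟨(Φ u').2 * ((Φ u).2)⁻¹, ?_, fun g hgu ↦ ?_⟩
  · apply Φ.injOn (hg _) hu2
    rw [((h u hu1).2 _).2]
    ext <;> simp [(h u' hu2).1, hu]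
  · rw [← hgu, ((h u hu1).2 g).2]; simp

theorem mdifferentiableAt_smul (hp : IsSmoothPrincipalBundle EG EM EP G p) (z : G × P) :
    MDifferentiableAt (𝓘(ℝ, EG).prod 𝓘(ℝ, EP)) 𝓘(ℝ, EP) (fun z : G × P ↦ z.1 • z.2) z :=
  (hp.contMDiff_smul z).mdifferentiableAt (by simp)

theorem mdifferentiableAt_const_smul (hp : IsSmoothPrincipalBundle EG EM EP G p) (g : G) (u : P) :
    MDifferentiableAt 𝓘(ℝ, EP) 𝓘(ℝ, EP) (fun x : P ↦ g • x) u :=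
  (mdifferentiableAt_smul hp (g, u)).comp u (mdifferentiableAt_const.prodMk mdifferentiableAt_id)

variable [IsManifold 𝓘(ℝ, EP) 1 P]

theorem ConnectionForm.form_congr (θ : ConnectionForm EG EP G P) {u u' : P} (h : u = u') (v : EP) :
    (θ.form u (v : TangentSpace 𝓘(ℝ, EP) u) : EG) =
      θ.form u' (v : TangentSpace 𝓘(ℝ, EP) u') := by
  subst h; rfl

theorem ConnectionForm.form_smul_eq_zero (hp : IsSmoothPrincipalBundle EG EM EP G p)
    (θ : ConnectionForm EG EP G P) {EN N : Type*} [NormedAddCommGroup EN] [NormedSpace ℝ EN]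
    [TopologicalSpace N] [ChartedSpace EN N] {f : N → P} {x : N}
    (hf : MDifferentiableAt 𝓘(ℝ, EN) 𝓘(ℝ, EP) f x) (v : TangentSpace 𝓘(ℝ, EN) x)
    (h : θ.form (f x) (mfderiv 𝓘(ℝ, EN) 𝓘(ℝ, EP) f x v) = 0) (g : G) :
    θ.form (g • f x) (mfderiv 𝓘(ℝ, EN) 𝓘(ℝ, EP) (fun y ↦ g • f y) x v) = 0 := by
  have : mfderiv 𝓘(ℝ, EN) 𝓘(ℝ, EP) (fun y ↦ g • f y) x =
      (mfderiv 𝓘(ℝ, EP) 𝓘(ℝ, EP) (fun u : P ↦ g • u) (f x)).comp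
        (mfderiv 𝓘(ℝ, EN) 𝓘(ℝ, EP) f x) :=
    mfderiv_comp x (mdifferentiableAt_const_smul hp g (f x)) hf
  rw [this]
  refine (θ.form_equivariant g (f x) _).trans ?_
  exact (congrArg (Ad EG g) h).trans (ContinuousLinearMap.map_zero _)

theorem IsHorizontalSection.mdifferentiableAt {θ : ConnectionForm EG EP G P} {s : M → P}
    {U : Set M} (hs : IsHorizontalSection EM θ p s U) {x : M} (hx : x ∈ U) :
    MDifferentiableAt 𝓘(ℝ, EM) 𝓘(ℝ, EP) s x :=
  (hs.contMDiffOn.contMDiffAt (hs.isOpen.mem_nhds hx)).mdifferentiableAt (by simp)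

theorem IsHorizontalSection.smul (hp : IsSmoothPrincipalBundle EG EM EP G p)
    {θ : ConnectionForm EG EP G P} {s : M → P} {U : Set M}
    (hs : IsHorizontalSection EM θ p s U) (g : G) :
    IsHorizontalSection EM θ p (fun x ↦ g • s x) U where
  isOpen := hs.isOpen
  contMDiffOn := hp.contMDiff_smul.comp_contMDiffOn (contMDiffOn_const.prodMk hs.contMDiffOn)
  proj x hx := by rw [hp.proj_smul, hs.proj x hx]
  horizontal x hx v :=
    θ.form_smul_eq_zero hp (hs.mdifferentiableAt hx) v (hs.horizontal x hx v) g

/-- A map into `P` with horizontal derivative locally stays in a horizontal sheet. -/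
theorem eventually_eq_section [LieGroup 𝓘(ℝ, EG) ∞ G]
    (hp : IsSmoothPrincipalBundle EG EM EP G p)
    {θ : ConnectionForm EG EP G P} {s : M → P} {U : Set M}
    (hs : IsHorizontalSection EM θ p s U)
    {EN N : Type*} [NormedAddCommGroup EN] [NormedSpace ℝ EN]
    [TopologicalSpace N] [ChartedSpace EN N] [IsManifold 𝓘(ℝ, EN) 1 N] {f : N → P} {y : N}
    (hf : ∀ᶠ z in 𝓝 y, MDifferentiableAt 𝓘(ℝ, EN) 𝓘(ℝ, EP) f z ∧
      ∀ v : TangentSpace 𝓘(ℝ, EN) z, θ.form (f z) (mfderiv 𝓘(ℝ, EN) 𝓘(ℝ, EP) f z v) = 0)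
    (hy : p (f y) ∈ U) (hsy : s (p (f y)) = f y) :
    ∀ᶠ z in 𝓝 y, f z = s (p (f z)) := by
  obtain ⟨V, Φ, hV, hm, hsrc, -, hΦ, -, h⟩ := hp.locallyTrivial (p (f y))
  have hpc : Continuous p := hp.contMDiff_proj.continuous
  have hcont : ContinuousAt (fun z ↦ p (f z)) y :=
    hpc.continuousAt.comp hf.self_of_nhds.1.continuousAt
  have hΦd : ∀ u ∈ Φ.source, MDifferentiableAt 𝓘(ℝ, EP) 𝓘(ℝ, EG) (fun u ↦ (Φ u).2) u := by
    intro u hu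
    have h1 : MDifferentiableAt 𝓘(ℝ, EP) (𝓘(ℝ, EM).prod 𝓘(ℝ, EG)) Φ u :=
      (hΦ.contMDiffAt (Φ.open_source.mem_nhds hu)).mdifferentiableAt (by simp)
    exact h1.snd
  have hgood : ∀ᶠ z in 𝓝 y, (MDifferentiableAt 𝓘(ℝ, EN) 𝓘(ℝ, EP) f z ∧
      ∀ v : TangentSpace 𝓘(ℝ, EN) z, θ.form (f z) (mfderiv 𝓘(ℝ, EN) 𝓘(ℝ, EP) f z v) = 0) ∧
      p (f z) ∈ U ∩ V := by
    refine hf.and (hcont.preimage_mem_nhds ((hs.isOpen.inter hV).mem_nhds ⟨hy, hm⟩))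
  let σ : N → P := fun z ↦ s (p (f z))
  let a : N → G := fun z ↦ (Φ (f z)).2 * ((Φ (σ z)).2)⁻¹
  have hs1 : ∀ z, p (f z) ∈ U ∩ V → f z ∈ Φ.source ∧ σ z ∈ Φ.source ∧ p (σ z) = p (f z) := by
    intro z hz
    have hσ : p (σ z) = p (f z) := hs.proj _ hz.1
    refine ⟨by rw [hsrc]; exact hz.2, ?_, hσ⟩
    rw [hsrc]; change p (σ z) ∈ V; rw [hσ]; exact hz.2
  have haσ : ∀ z, p (f z) ∈ U ∩ V → f z = a z • σ z := by
    intro z hz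
    obtain ⟨h1, h2, h3⟩ := hs1 z hz
    have h4 : a z • σ z ∈ Φ.source := by
      rw [hsrc]; change p (a z • σ z) ∈ V; rw [hp.proj_smul, h3]; exact hz.2
    refine Φ.injOn h1 h4 ?_
    rw [((h _ h2).2 _).2]
    ext
    · rw [(h _ h1).1, h3]
    · simp [a]
  have hσd : ∀ z, MDifferentiableAt 𝓘(ℝ, EN) 𝓘(ℝ, EP) f z → p (f z) ∈ U ∩ V →
      MDifferentiableAt 𝓘(ℝ, EN) 𝓘(ℝ, EP) σ z := by
    intro z hd hz
    exact (hs.mdifferentiableAt hz.1).comp z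
      (((hp.contMDiff_proj (f z)).mdifferentiableAt (by simp)).comp z hd)
  have hσ0 : ∀ z, MDifferentiableAt 𝓘(ℝ, EN) 𝓘(ℝ, EP) f z → p (f z) ∈ U ∩ V →
      ∀ v : TangentSpace 𝓘(ℝ, EN) z,
        θ.form (σ z) (mfderiv 𝓘(ℝ, EN) 𝓘(ℝ, EP) σ z v) = 0 := by
    intro z hd hz v
    have hpf : MDifferentiableAt 𝓘(ℝ, EN) 𝓘(ℝ, EM) (fun z ↦ p (f z)) z :=
      ((hp.contMDiff_proj (f z)).mdifferentiableAt (by simp)).comp z hd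
    have : mfderiv 𝓘(ℝ, EN) 𝓘(ℝ, EP) σ z =
        (mfderiv 𝓘(ℝ, EM) 𝓘(ℝ, EP) s (p (f z))).comp
          (mfderiv 𝓘(ℝ, EN) 𝓘(ℝ, EM) (fun z ↦ p (f z)) z) :=
      mfderiv_comp z (hs.mdifferentiableAt hz.1) hpf
    rw [this]
    exact hs.horizontal _ hz.1 _
  have had : ∀ z, MDifferentiableAt 𝓘(ℝ, EN) 𝓘(ℝ, EP) f z → p (f z) ∈ U ∩ V →
      MDifferentiableAt 𝓘(ℝ, EN) 𝓘(ℝ, EG) a z := by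
    intro z hd hz
    obtain ⟨h1, h2, h3⟩ := hs1 z hz
    have d1 : MDifferentiableAt 𝓘(ℝ, EN) 𝓘(ℝ, EG) (fun z ↦ (Φ (f z)).2) z :=
      (hΦd _ h1).comp z hd
    have d2 : MDifferentiableAt 𝓘(ℝ, EN) 𝓘(ℝ, EG) (fun z ↦ (Φ (σ z)).2) z :=
      (hΦd _ h2).comp z (hσd z hd hz)
    have d3 : MDifferentiableAt (𝓘(ℝ, EG).prod 𝓘(ℝ, EG)) 𝓘(ℝ, EG)
        (fun x : G × G ↦ x.1 * x.2⁻¹) ((Φ (f z)).2, (Φ (σ z)).2) :=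
      ((contMDiff_fst.mul (contMDiff_snd.inv) :
        ContMDiff (𝓘(ℝ, EG).prod 𝓘(ℝ, EG)) 𝓘(ℝ, EG) ∞
          (fun x : G × G ↦ x.1 * x.2⁻¹)) _).mdifferentiableAt (by simp)
    exact MDifferentiableAt.comp (g := fun x : G × G ↦ x.1 * x.2⁻¹) z d3 (d1.prodMk d2)
  have hmulr : ∀ (b x : G), MDifferentiableAt 𝓘(ℝ, EG) 𝓘(ℝ, EG) (fun x : G ↦ x * b) x :=
    fun b x ↦ ((contMDiff_mul_right (I := 𝓘(ℝ, EG)) (n := ∞) (a := b)) x).mdifferentiableAt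
      (by simp)
  have ha0 : ∀ᶠ z in 𝓝 y, MDifferentiableAt 𝓘(ℝ, EN) 𝓘(ℝ, EG) a z ∧
      mfderiv 𝓘(ℝ, EN) 𝓘(ℝ, EG) a z = 0 := by
    filter_upwards [hgood.eventually_nhds] with z hz'
    have hz := hz'.self_of_nhds
    obtain ⟨⟨hd, h0⟩, hzUV⟩ := hz
    have hda := had z hd hzUV
    refine ⟨hda, ?_⟩
    let b : N → G := fun w ↦ a w * (a z)⁻¹
    let k : N → P := fun w ↦ a z • σ w
    have hbz : b z = 1 := by simp [b]
    have hkz : k z = f z := (haσ z hzUV).symm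
    have hdb : MDifferentiableAt 𝓘(ℝ, EN) 𝓘(ℝ, EG) b z := (hmulr _ _).comp z hda
    have hdk : MDifferentiableAt 𝓘(ℝ, EN) 𝓘(ℝ, EP) k z :=
      (mdifferentiableAt_const_smul hp _ _).comp z (hσd z hd hzUV)
    have hk0 : ∀ v : TangentSpace 𝓘(ℝ, EN) z,
        θ.form (k z) (mfderiv 𝓘(ℝ, EN) 𝓘(ℝ, EP) k z v) = 0 :=
      fun v ↦ θ.form_smul_eq_zero hp (hσd z hd hzUV) v (hσ0 z hd hzUV v) (a z)
    have hfbk : f =ᶠ[𝓝 z] fun w ↦ b w • k w := by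
      filter_upwards [hz'] with w hw
      rw [haσ w hw.2]
      simp [b, k, smul_smul]
    have hb0 : ∀ v : TangentSpace 𝓘(ℝ, EN) z,
        (mfderiv 𝓘(ℝ, EN) 𝓘(ℝ, EG) b z v : EG) = 0 := by
      intro v
      have e1' : ∀ pt : G × P, pt = (b z, k z) →
          (mfderiv 𝓘(ℝ, EN) 𝓘(ℝ, EP) (fun w ↦ b w • k w) z : EN →L[ℝ] EP) =
          ContinuousLinearMap.comp (mfderiv (𝓘(ℝ, EG).prod 𝓘(ℝ, EP)) 𝓘(ℝ, EP)
            (fun x : G × P ↦ x.1 • x.2) pt : EG × EP →L[ℝ] EP)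
            (mfderiv 𝓘(ℝ, EN) (𝓘(ℝ, EG).prod 𝓘(ℝ, EP)) (fun w ↦ (b w, k w)) z :
              EN →L[ℝ] EG × EP) := by
        rintro _ rfl
        exact mfderiv_comp (g := fun x : G × P ↦ x.1 • x.2) z (mdifferentiableAt_smul hp _)
          (hdb.prodMk hdk)
      have e1 := e1' ((1 : G), k z) (by rw [hbz])
      rw [mfderiv_prodMk hdb hdk] at e1
      have e2 : (mfderiv 𝓘(ℝ, EN) 𝓘(ℝ, EP) f z v : EP) =
          (mfderiv 𝓘(ℝ, EG) 𝓘(ℝ, EP) (fun g : G ↦ g • k z) (1 : G)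
            (mfderiv 𝓘(ℝ, EN) 𝓘(ℝ, EG) b z v : EG) : EP) +
          (mfderiv 𝓘(ℝ, EP) 𝓘(ℝ, EP) (fun x : P ↦ (1 : G) • x) (k z)
            (mfderiv 𝓘(ℝ, EN) 𝓘(ℝ, EP) k z v : EP) : EP) := by
        rw [hfbk.mfderiv_eq]
        refine (congrArg (fun c : EN →L[ℝ] EP ↦ c v) e1).trans ?_
        exact mfderiv_prod_eq_add_apply (p := ((1 : G), k z)) (mdifferentiableAt_smul hp _)
      let L : EP →L[ℝ] EG := θ.form (k z)
      have e3 : L (mfderiv 𝓘(ℝ, EN) 𝓘(ℝ, EP) f z v : EP) = 0 :=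
        (θ.form_congr hkz _).trans (h0 v)
      have e4 : L (mfderiv 𝓘(ℝ, EG) 𝓘(ℝ, EP) (fun g : G ↦ g • k z) (1 : G)
            (mfderiv 𝓘(ℝ, EN) 𝓘(ℝ, EG) b z v : EG) : EP) =
          (mfderiv 𝓘(ℝ, EN) 𝓘(ℝ, EG) b z v : EG) :=
        (θ.form_congr (one_smul G (k z)).symm _).trans
          (θ.form_fundamental (k z) (mfderiv 𝓘(ℝ, EN) 𝓘(ℝ, EG) b z v : EG))
      have e5 : (mfderiv 𝓘(ℝ, EP) 𝓘(ℝ, EP) (fun x : P ↦ (1 : G) • x) (k z)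
            (mfderiv 𝓘(ℝ, EN) 𝓘(ℝ, EP) k z v : EP) : EP) =
          (mfderiv 𝓘(ℝ, EN) 𝓘(ℝ, EP) k z v : EP) := by
        have : (fun x : P ↦ (1 : G) • x) = id := funext fun x ↦ one_smul G x
        rw [this, mfderiv_id]; rfl
      have e6 : L (mfderiv 𝓘(ℝ, EN) 𝓘(ℝ, EP) k z v : EP) = 0 := hk0 v
      have e7 : ∀ (A B : EP) (c : EG), L (A + B) = 0 → L A = c → L B = 0 → c = 0 := by
        intro A B c hAB hA hB
        rw [L.map_add, hA, hB, add_zero] at hAB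
        exact hAB
      rw [e2, e5] at e3
      exact e7 _ _ _ e3 e4 e6
    have hab : a = fun w ↦ b w * a z := by funext w; simp [b]
    have e7 : mfderiv 𝓘(ℝ, EN) 𝓘(ℝ, EG) (fun w ↦ b w * a z) z =
        (mfderiv 𝓘(ℝ, EG) 𝓘(ℝ, EG) (fun x : G ↦ x * a z) (b z)).comp
          (mfderiv 𝓘(ℝ, EN) 𝓘(ℝ, EG) b z) :=
      mfderiv_comp z (hmulr _ _) hdb
    let R : EG →L[ℝ] EG := mfderiv 𝓘(ℝ, EG) 𝓘(ℝ, EG) (fun x : G ↦ x * a z) (b z)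
    have e8 : mfderiv 𝓘(ℝ, EN) 𝓘(ℝ, EG) (fun w ↦ b w * a z) z = 0 := by
      rw [e7]
      refine @ContinuousLinearMap.ext ℝ ℝ _ _ _ EN _ _ EG _ _ _ _ _ _ fun v ↦ ?_
      exact (congrArg R (hb0 v)).trans R.map_zero
    have e9 : ∀ c : N → G, c = a → (mfderiv 𝓘(ℝ, EN) 𝓘(ℝ, EG) c z : EN →L[ℝ] EG) = 0 →
        (mfderiv 𝓘(ℝ, EN) 𝓘(ℝ, EG) a z : EN →L[ℝ] EG) = 0 := by
      rintro _ rfl h; exact h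
    exact e9 _ hab.symm e8
  filter_upwards [eventually_eq_of_mfderiv_eq_zero ha0, hgood] with z hz hzg
  have hay : a y = 1 := by
    have : σ y = f y := hsy
    simp [a, this]
  rw [hay] at hz
  simpa [hz] using haσ z hzg.2

end

noncomputable section

variable {EG EM EP : Type*}
  [NormedAddCommGroup EG] [NormedSpace ℝ EG]
  [NormedAddCommGroup EM] [NormedSpace ℝ EM]
  [NormedAddCommGroup EP] [NormedSpace ℝ EP]
  {G M P : Type*} [Group G] [TopologicalSpace G] [ChartedSpace EG G]
  [TopologicalSpace M] [ChartedSpace EM M]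
  [TopologicalSpace P] [ChartedSpace EP P] [IsManifold 𝓘(ℝ, EP) 1 P] [MulAction G P]
  {θ : ConnectionForm EG EP G P} {p : P → M}

theorem IsHorizontalLift.smul (hp : IsSmoothPrincipalBundle EG EM EP G p)
    {x₀ : P} {w : C(unitInterval, M)} {c c' : C(unitInterval, P)} {g : G}
    (hc : IsHorizontalLift EM θ p x₀ w c) (hcc : ∀ t, c' t = g • c t) :
    IsHorizontalLift EM θ p (g • x₀) w c' where
  isHorizontalPath t := by
    obtain ⟨U, s, hs, ht, h⟩ := hc.isHorizontalPath t
    refine ⟨U, _, hs.smul hp g, by rwa [hcc, hp.proj_smul], ?_⟩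
    filter_upwards [h] with t' ht'
    rw [hcc, hp.proj_smul, ← ht']
  proj t := by rw [hcc, hp.proj_smul, hc.proj]
  source := by rw [hcc, hc.source]

/-- A differentiable curve with horizontal velocities is a horizontal path. -/
theorem isHorizontalPath_of_velocity [LieGroup 𝓘(ℝ, EG) ∞ G]
    (hp : IsSmoothPrincipalBundle EG EM EP G p)
    (hθ : θ.IsFlat EM p) (c : C(unitInterval, P)) (γ : ℝ → P) (hc : ∀ t : unitInterval, c t = γ t)
    (hγ : ∀ t : unitInterval, ∀ᶠ r in 𝓝 (t : ℝ), MDifferentiableAt 𝓘(ℝ, ℝ) 𝓘(ℝ, EP) γ r ∧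
      ∀ v : TangentSpace 𝓘(ℝ, ℝ) r, θ.form (γ r) (mfderiv 𝓘(ℝ, ℝ) 𝓘(ℝ, EP) γ r v) = 0) :
    IsHorizontalPath EM θ p c := by
  intro t
  obtain ⟨U, s, hm, hs⟩ := hθ (p (c t))
  obtain ⟨g, hg, -⟩ := hp.existsUnique_smul_eq (u := s (p (c t))) (u' := c t)
    (hs.proj _ hm).symm
  refine ⟨U, _, hs.smul hp g, hm, ?_⟩
  have h := eventually_eq_section hp (hs.smul hp g) (hγ t) (by rwa [← hc])
    (by rw [← hc]; exact hg)
  have ht : Tendsto (fun r : unitInterval ↦ (r : ℝ)) (𝓝 t) (𝓝 (t : ℝ)) :=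
    continuous_subtype_val.continuousAt
  filter_upwards [ht.eventually h] with r hr
  rw [hc r]; exact hr

/-- The space `P` with the leaf topology of the horizontal foliation, that is, the final topology
for all horizontal sections. Its path components are the maximal horizontal leaves. -/
def LeafSpace (EM : Type*) [NormedAddCommGroup EM] [NormedSpace ℝ EM]
    {M : Type*} [TopologicalSpace M] [ChartedSpace EM M]
    (_θ : ConnectionForm EG EP G P) (_p : P → M) : Type _ := P

variable (EM θ p) in
/-- The identity map from `P` to `P` with the leaf topology. -/
def toLeaf : P → LeafSpace EM θ p := fun u ↦ u

/-- The identity map from `P` with the leaf topology to `P`. -/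
def ofLeaf : LeafSpace EM θ p → P := fun u ↦ u

variable (EM θ p) in
/-- The bundle projection on the leaf space. -/
def leafProj : LeafSpace EM θ p → M := fun u ↦ p (ofLeaf u)

instance : TopologicalSpace (LeafSpace EM θ p) where
  IsOpen W := ∀ (s : M → P) (U : Set M), IsHorizontalSection EM θ p s U →
    IsOpen (U ∩ {x | toLeaf EM θ p (s x) ∈ W})
  isOpen_univ s U hs := by simpa using hs.isOpen
  isOpen_inter W W' h h' s U hs := by
    have := (h s U hs).inter (h' s U hs)
    convert! this using 1
    ext x
    constructor
    · rintro ⟨h1, h2, h3⟩; exact ⟨⟨h1, h2⟩, h1, h3⟩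
    · rintro ⟨⟨h1, h2⟩, -, h3⟩; exact ⟨h1, h2, h3⟩
  isOpen_sUnion S h s U hs := by
    have : U ∩ {x | toLeaf EM θ p (s x) ∈ ⋃₀ S} =
        ⋃ W ∈ S, U ∩ {x | toLeaf EM θ p (s x) ∈ W} := by
      ext x; simp
    exact this ▸ isOpen_biUnion fun W hW ↦ h W hW s U hs

theorem isOpen_leafSpace_iff {W : Set (LeafSpace EM θ p)} :
    IsOpen W ↔ ∀ (s : M → P) (U : Set M), IsHorizontalSection EM θ p s U →
      IsOpen (U ∩ {x | toLeaf EM θ p (s x) ∈ W}) := Iff.rfl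

theorem continuous_ofLeaf : Continuous (ofLeaf : LeafSpace EM θ p → P) :=
  ⟨fun _ hW ↦ isOpen_leafSpace_iff.2 fun _ _ hs ↦
    hs.contMDiffOn.continuousOn.isOpen_inter_preimage hs.isOpen hW⟩

variable [IsManifold 𝓘(ℝ, EM) 1 M] [LieGroup 𝓘(ℝ, EG) ∞ G]

theorem isOpen_sheet (hp : IsSmoothPrincipalBundle EG EM EP G p) {s : M → P} {U V : Set M}
    (hs : IsHorizontalSection EM θ p s U) (hV : IsOpen V) (hVU : V ⊆ U) :
    IsOpen ((fun x ↦ toLeaf EM θ p (s x)) '' V) := by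
  refine isOpen_leafSpace_iff.2 fun t U' ht ↦ ?_
  rw [isOpen_iff_mem_nhds]
  rintro x ⟨hx, z, hz, hzx'⟩
  have hzx : s z = t x := hzx'
  have hxz : z = x := by rw [← hs.proj z (hVU hz), ← ht.proj x hx, hzx]
  subst hxz
  have hU' := ht.isOpen.mem_nhds hx
  have := eventually_eq_section hp hs (f := t) (y := z)
    (by filter_upwards [hU'] with w hw using ⟨ht.mdifferentiableAt hw, ht.horizontal w hw⟩)
    (by rw [ht.proj z hx]; exact hVU hz) (by rw [ht.proj z hx, hzx])
  filter_upwards [this, hU', hV.mem_nhds hz] with w hw hwU hwV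
  refine ⟨hwU, w, hwV, ?_⟩
  change s w = t w
  rw [hw, ht.proj w hwU]

/-- A copy of `G` with the discrete topology. -/
def DiscreteCopy (G : Type*) : Type _ := G

instance (G : Type*) : TopologicalSpace (DiscreteCopy G) := ⊥

instance (G : Type*) : DiscreteTopology (DiscreteCopy G) := ⟨rfl⟩

theorem isCoveringMap_leafProj (hp : IsSmoothPrincipalBundle EG EM EP G p) (hθ : θ.IsFlat EM p) :
    IsCoveringMap (leafProj EM θ p) := by
  intro m
  obtain ⟨U, s, hm, hs⟩ := hθ m
  have : Nonempty (M → LeafSpace EM θ p) := ⟨fun x ↦ toLeaf EM θ p (s x)⟩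
  have : Nonempty (DiscreteCopy G) := ⟨(1 : G)⟩
  have key : ∀ (g : G) {W : Set M}, W ⊆ U →
      (leafProj EM θ p ⁻¹' W ∩ (fun x ↦ toLeaf EM θ p (g • s x)) '' U) =
        (fun x ↦ toLeaf EM θ p (g • s x)) '' W := by
    intro g W hW
    ext u
    constructor
    · rintro ⟨hu, x, hx, rfl⟩
      refine ⟨x, ?_, rfl⟩
      have : p (g • s x) ∈ W := hu
      rwa [hp.proj_smul, hs.proj x hx] at this
    · rintro ⟨x, hx, rfl⟩
      refine ⟨?_, x, hW hx, rfl⟩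
      change p (g • s x) ∈ W
      rwa [hp.proj_smul, hs.proj x (hW hx)]
  refine IsEvenlyCovered.to_isEvenlyCovered_preimage (I := DiscreteCopy G)
    (IsEvenlyCovered.of_trivialization (I := DiscreteCopy G)
      (t := IsOpen.trivializationDiscrete (f := leafProj EM θ p) (ι := DiscreteCopy G)
        (fun g : G ↦ (fun x ↦ toLeaf EM θ p (g • s x)) '' U) U hs.isOpen ?_ ?_ ?_ ?_ ?_) hm)
  · intro (g : G) W hW
    rw [key g hW]
    refine ⟨fun h ↦ isOpen_sheet hp (hs.smul hp g) h hW, fun h ↦ ?_⟩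
    convert! isOpen_leafSpace_iff.1 h _ U (hs.smul hp g) using 1
    ext x
    constructor
    · exact fun hx ↦ ⟨hW hx, x, hx, rfl⟩
    · rintro ⟨hx, z, hz, hzx⟩
      have : p (g • s z) = p (g • s x) := congrArg p hzx
      rw [hp.proj_smul, hp.proj_smul, hs.proj _ hx, hs.proj _ (hW hz)] at this
      exact this ▸ hz
  · rintro (g : G) _ ⟨x, hx, rfl⟩ _ ⟨z, hz, rfl⟩ h
    have : p (g • s x) = p (g • s z) := h
    rw [hp.proj_smul, hp.proj_smul, hs.proj _ hx, hs.proj _ hz] at this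
    subst this; rfl
  · intro (g : G) x hx
    exact ⟨_, ⟨x, hx, rfl⟩, (hp.proj_smul g (s x)).trans (hs.proj x hx)⟩
  · intro (g : G) (g' : G) hgg
    refine Set.disjoint_left.2 ?_
    rintro _ ⟨x, hx, rfl⟩ ⟨z, hz, h⟩
    apply hgg
    have h' : g' • s z = g • s x := h
    have h1 := congrArg p h'
    rw [hp.proj_smul, hp.proj_smul, hs.proj _ hx, hs.proj _ hz] at h1
    subst h1
    exact (hp.existsUnique_smul_eq (hp.proj_smul g (s z))).unique rfl h'
  · intro u hu
    have hu' : p u ∈ U := hu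
    obtain ⟨g, hg, -⟩ := hp.existsUnique_smul_eq (u := s (p u)) (u' := u) (hs.proj _ hu').symm
    exact Set.mem_iUnion.2 ⟨g, p u, hu', hg⟩

theorem isHorizontalPath_iff_continuous (hp : IsSmoothPrincipalBundle EG EM EP G p)
    (hθ : θ.IsFlat EM p) (c : C(unitInterval, P)) :
    IsHorizontalPath EM θ p c ↔ Continuous (fun t ↦ toLeaf EM θ p (c t)) := by
  have hpc : Continuous p := hp.contMDiff_proj.continuous
  constructor
  · intro h
    refine continuous_iff_continuousAt.2 fun t ↦ ?_
    obtain ⟨U, s, hs, ht, hc⟩ := h t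
    intro W hW
    obtain ⟨W', hW', hWo, htW⟩ := mem_nhds_iff.1 hW
    have hmem : p (c t) ∈ U ∩ {x | toLeaf EM θ p (s x) ∈ W'} := by
      refine ⟨ht, ?_⟩
      change toLeaf EM θ p (s (p (c t))) ∈ W'
      rw [← hc.self_of_nhds]; exact htW
    have := (hpc.comp c.continuous).continuousAt.preimage_mem_nhds ((isOpen_leafSpace_iff.1 hWo s U hs).mem_nhds hmem)
    refine Filter.mem_map.2 ?_
    filter_upwards [this, hc] with t' h1 h2
    refine hW' ?_
    change toLeaf EM θ p (c t') ∈ W'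
    have h3 : toLeaf EM θ p (s (p (c t'))) ∈ W' := h1.2
    rw [← h2] at h3
    exact h3
  · intro h t
    obtain ⟨U, s, hm, hs⟩ := hθ (p (c t))
    obtain ⟨g, hg, -⟩ := hp.existsUnique_smul_eq (u := s (p (c t))) (u' := c t)
      (hs.proj _ hm).symm
    refine ⟨U, _, hs.smul hp g, hm, ?_⟩
    have := h.continuousAt.preimage_mem_nhds
      ((isOpen_sheet hp (hs.smul hp g) hs.isOpen subset_rfl).mem_nhds ⟨p (c t), hm, hg⟩)
    filter_upwards [this] with t' ht'
    obtain ⟨x, hx, hxc⟩ := ht'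
    have hxc' : g • s x = c t' := hxc
    have : p (c t') = x := by rw [← hxc', hp.proj_smul, hs.proj x hx]
    rw [this, hxc']

theorem IsHorizontalLift.unique (hp : IsSmoothPrincipalBundle EG EM EP G p)
    (hθ : θ.IsFlat EM p) {x₀ : P} {w : C(unitInterval, M)} {c c' : C(unitInterval, P)}
    (hc : IsHorizontalLift EM θ p x₀ w c) (hc' : IsHorizontalLift EM θ p x₀ w c') : c = c' := by
  have h1 := (isHorizontalPath_iff_continuous hp hθ c).1 hc.isHorizontalPath
  have h2 := (isHorizontalPath_iff_continuous hp hθ c').1 hc'.isHorizontalPath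
  have := (isCoveringMap_leafProj hp hθ).eq_of_comp_eq h1 h2
    (funext fun t ↦ (hc.proj t).trans (hc'.proj t).symm) 0
    (congrArg (toLeaf EM θ p) (hc.source.trans hc'.source.symm))
  exact ContinuousMap.ext fun t ↦ congrFun this t

theorem isHorizontalLift_liftPath (hp : IsSmoothPrincipalBundle EG EM EP G p)
    (hθ : θ.IsFlat EM p) (x₀ : P) (w : C(unitInterval, M)) (hw : w 0 = p x₀) :
    IsHorizontalLift EM θ p x₀ w ((⟨ofLeaf, continuous_ofLeaf⟩ : C(LeafSpace EM θ p, P)).comp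
      ((isCoveringMap_leafProj hp hθ).liftPath w (toLeaf EM θ p x₀) hw)) where
  isHorizontalPath := (isHorizontalPath_iff_continuous hp hθ _).2
    ((isCoveringMap_leafProj hp hθ).liftPath w (toLeaf EM θ p x₀) hw).continuous
  proj t := congrFun ((isCoveringMap_leafProj hp hθ).liftPath_lifts w (toLeaf EM θ p x₀) hw) t
  source := (isCoveringMap_leafProj hp hθ).liftPath_zero w (toLeaf EM θ p x₀) hw

variable (EM) in
/-- `h` is the holonomy homomorphism at `x₀` : every loop `w` at `p x₀` has a horizontal lift
starting at `x₀`, and this lift ends at `h [w] • x₀`.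

In `FundamentalGroup` the product `a * b` is the class of "first `b`, then `a`", which is opposite
to the usual order of concatenation; a homomorphism to `G` for the latter is a homomorphism from
`FundamentalGroup` to the opposite group of `G`. The kernel is not affected. -/
def IsHolonomyHom (θ : ConnectionForm EG EP G P) (p : P → M) (x₀ : P)
    (h : FundamentalGroup M (p x₀) →* Gᵐᵒᵖ) : Prop :=
  ∀ w : Path (p x₀) (p x₀), (∃ c, IsHorizontalLift EM θ p x₀ w c) ∧
    ∀ c, IsHorizontalLift EM θ p x₀ w c →
      c 1 = (h (FundamentalGroup.fromPath (Path.Homotopic.Quotient.mk w))).unop • x₀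

theorem existsUnique_holonomyHom (hp : IsSmoothPrincipalBundle EG EM EP G p)
    (hθ : θ.IsFlat EM p) (x₀ : P) : ∃! h, IsHolonomyHom EM θ p x₀ h := by
  let cov := isCoveringMap_leafProj hp hθ
  have hlift := isHorizontalLift_liftPath hp hθ
  have hex : ∀ γ : FundamentalGroup M (p x₀), ∃ g : G,
      g • x₀ = ofLeaf (cov.monodromy γ.toPath ⟨toLeaf EM θ p x₀, rfl⟩).1 := fun γ ↦
    (hp.existsUnique_smul_eq (cov.monodromy γ.toPath ⟨toLeaf EM θ p x₀, rfl⟩).2).exists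
  choose k hk using hex
  have hinj : ∀ g g' : G, g • x₀ = g' • x₀ → g = g' := fun g g' h ↦
    (hp.existsUnique_smul_eq (hp.proj_smul g' x₀)).unique h rfl
  have hend : ∀ (w : Path (p x₀) (p x₀)) (c), IsHorizontalLift EM θ p x₀ w c →
      c 1 = k (FundamentalGroup.fromPath (Path.Homotopic.Quotient.mk w)) • x₀ := by
    intro w c hc
    rw [hk, hc.unique hp hθ (hlift x₀ w w.source)]
    rfl
  have hmul : ∀ γ δ : FundamentalGroup M (p x₀), k (γ * δ) = k δ * k γ := by
    intro γ δ
    have hequiv : ∀ (g : G) (hg : p (g • x₀) = p x₀),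
        ofLeaf (cov.monodromy γ.toPath ⟨toLeaf EM θ p (g • x₀), hg⟩).1 =
          g • ofLeaf (cov.monodromy γ.toPath ⟨toLeaf EM θ p x₀, rfl⟩).1 := by
      intro g hg
      obtain ⟨w, rfl⟩ := Path.Homotopic.Quotient.mk_surjective γ
      have h1 := hlift (g • x₀) w (w.source.trans hg.symm)
      have hgc : Continuous (fun u : P ↦ g • u) :=
        hp.contMDiff_smul.continuous.comp (continuous_const.prodMk continuous_id)
      have h2 := (hlift x₀ w w.source).smul hp (g := g)
        (c' := (⟨_, hgc⟩ : C(P, P)).comp _) (fun t ↦ rfl)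
      exact congrArg (fun c : C(unitInterval, P) ↦ c 1) (h1.unique hp hθ h2)
    apply hinj
    rw [hk, mul_smul, hk γ]
    have h3 := cov.monodromy_trans_apply δ.toPath γ.toPath ⟨toLeaf EM θ p x₀, rfl⟩
    have h4 : cov.monodromy δ.toPath ⟨toLeaf EM θ p x₀, rfl⟩ =
        ⟨toLeaf EM θ p (k δ • x₀), hp.proj_smul _ _⟩ := Subtype.ext (hk δ).symm
    rw [h4] at h3
    rw [← hequiv (k δ) (hp.proj_smul _ _)]
    exact congrArg (fun e ↦ ofLeaf e.1) h3
  refine ⟨MonoidHom.mk' (fun γ ↦ MulOpposite.op (k γ)) fun γ δ ↦ ?_, fun w ↦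
    ⟨⟨_, hlift x₀ w w.source⟩, fun c hc ↦ hend w c hc⟩, fun h' hh' ↦ ?_⟩
  · rw [hmul]; rfl
  · refine MonoidHom.ext fun γ ↦ ?_
    obtain ⟨w, rfl⟩ := Path.Homotopic.Quotient.mk_surjective γ
    refine MulOpposite.unop_injective (hinj _ _ ?_)
    have hc := hlift x₀ w w.source
    exact ((hh' w).2 _ hc).symm.trans (hend w _ hc)

/-- The holonomy homomorphism of a flat connection at the point `x₀` of the total space. -/
def holonomyHom (hp : IsSmoothPrincipalBundle EG EM EP G p) (hθ : θ.IsFlat EM p) (x₀ : P) :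
    FundamentalGroup M (p x₀) →* Gᵐᵒᵖ :=
  (existsUnique_holonomyHom hp hθ x₀).choose

theorem holonomyHom_spec (hp : IsSmoothPrincipalBundle EG EM EP G p) (hθ : θ.IsFlat EM p)
    (x₀ : P) : IsHolonomyHom EM θ p x₀ (holonomyHom hp hθ x₀) :=
  (existsUnique_holonomyHom hp hθ x₀).choose_spec.1

end

/-- `q` is a covering of smooth manifolds: a covering map that is a local diffeomorphism. -/
structure IsSmoothCovering (EM : Type*) [NormedAddCommGroup EM] [NormedSpace ℝ EM]
    {M N : Type*} [TopologicalSpace M] [ChartedSpace EM M] [TopologicalSpace N] [ChartedSpace EM N]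
    (q : N → M) : Prop where
  isCoveringMap : IsCoveringMap q
  isLocalDiffeomorph : IsLocalDiffeomorph 𝓘(ℝ, EM) 𝓘(ℝ, EM) ∞ q

/-- The total space `{(y, u) | q y = p u}` of the bundle induced from `p : P → M` by `q : N → M`. -/
abbrev InducedBundle {M N P : Type*} (q : N → M) (p : P → M) : Type _ := Function.Pullback q p

/-- The projection `(y, u) ↦ u` of the induced bundle to `P`. -/
def InducedBundle.toTotal {M N P : Type*} [TopologicalSpace N] [TopologicalSpace P]
    (q : N → M) (p : P → M) : C(InducedBundle q p, P) :=
  ⟨fun z ↦ z.1.2, continuous_snd.comp continuous_subtype_val⟩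

end FlatBundle

open FlatBundle

/-! A path in the fibre product of `q` and `p` is a pair of paths, `δ` in `N` and `γ` in `P`, with
`q ∘ δ = p ∘ γ`. Since `q` is a covering, `δ` is determined by `γ` and its starting point: it is the
lift of `p ∘ γ`. The same holds for homotopies. In other words, the projection to `P` is the
covering `q` pulled back along `p`; the proof works directly with lifts in `N`.

Injectivity is homotopy lifting. If the projections to `P` of two loops are joined by a homotopy `F`
fixing the endpoints, then `p ∘ F` lifts to `N`, and the pair of this lift and `F` is a homotopy
between the original loops (`homotopic_of_map_toTotal`).

For the image, a loop `γ` at `x₀` comes from a loop in the fibre product exactly when the lift of `p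
∘ γ` from `y₀` closes up, which happens exactly when the class of `p ∘ γ` lies in `q_# π₁(N, y₀)`
(`range_mapOfEq_toTotal`). The connection enters at the end: by hypothesis this subgroup is the
kernel of the holonomy homomorphism. -/

namespace FlatBundle.InducedBundle

variable {M N P : Type*} [TopologicalSpace M] [TopologicalSpace N] [TopologicalSpace P]
  {q : N → M} {p : P → M}

/-! ### Lifting of homotopies and injectivity -/

/-- Homotopic projections to `P` lift to homotopic paths in the bundle induced by a covering. -/
theorem homotopic_of_map_toTotal (hq : IsCoveringMap q) (hp : Continuous p)
    {z z' : InducedBundle q p} {γ₀ γ₁ : Path z z'}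
    (h : (γ₀.map (toTotal q p).continuous).Homotopic (γ₁.map (toTotal q p).continuous)) :
    γ₀.Homotopic γ₁ := by
  obtain ⟨F⟩ := h
  have hfst : Continuous fun z : InducedBundle q p ↦ z.1.1 :=
    continuous_fst.comp continuous_subtype_val
  let B := F.compContinuousMap (⟨p, hp⟩ : C(P, M))
  -- By the defining equation of the fibre product, the `N`-components of `γ₀` and `γ₁` lift the two
  -- end paths of `B = p ∘ F`. They agree at the parameter `0`, so uniqueness of lifts makes the
  -- lift of `B` that begins with the first component end with the second, and the endpoints stay
  -- fixed.
  let A := hq.liftHomotopyRel B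
    (f₀' := (γ₀.map hfst).toContinuousMap) (f₁' := (γ₁.map hfst).toContinuousMap)
    ⟨0, .inl rfl, (γ₀.map hfst).source.trans (γ₁.map hfst).source.symm⟩
    (funext fun t ↦ (γ₀ t).2) (funext fun t ↦ (γ₁ t).2)
  -- `A` has the ordinary homotopy lift as its underlying map, so it projects to `B`. This is the
  -- condition for `(A, F)` to take values in the fibre product.
  have hA : ∀ s, q (A s) = p (F s) := fun s ↦
    congrFun (hq.liftHomotopy_lifts B.toContinuousMap (γ₀.map hfst).toContinuousMap
      fun a ↦ (B.apply_zero a).trans (γ₀ a).2.symm) s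
  exact ⟨{
    toFun := fun s ↦ ⟨(A s, F s), hA s⟩
    continuous_toFun := (A.continuous.prodMk F.continuous).subtype_mk _
    map_zero_left := fun t ↦ Subtype.ext (Prod.ext (A.apply_zero t) (F.apply_zero t))
    map_one_left := fun t ↦ Subtype.ext (Prod.ext (A.apply_one t) (F.apply_one t))
    prop' := fun t a ha ↦ Subtype.ext (Prod.ext (A.prop t a ha) (F.prop t a ha)) }⟩

/-- Passes between equalities in fundamental groups and homotopies of representing loops. The cast
along `h` is needed because `q y₀` and `p x₀` are equal only by the hypothesis `h₀`, not by
definition. -/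
theorem mapOfEq_mk {X Y : Type*} [TopologicalSpace X] [TopologicalSpace Y] (f : C(X, Y)) {x : X}
    {y : Y} (h : f x = y) (γ : Path x x) :
    FundamentalGroup.mapOfEq f h (Path.Homotopic.Quotient.mk γ) =
      Path.Homotopic.Quotient.mk ((γ.map f.continuous).cast h.symm h.symm) :=
  FundamentalGroup.mapOfEq_apply f h _

theorem mapOfEq_toTotal_injective (hq : IsCoveringMap q) (hp : Continuous p)
    (z : InducedBundle q p) :
    Function.Injective
      (FundamentalGroup.mapOfEq (toTotal q p) rfl : FundamentalGroup _ z →* _) := by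
  intro α β h
  obtain ⟨γ₀, rfl⟩ := Path.Homotopic.Quotient.mk_surjective α
  obtain ⟨γ₁, rfl⟩ := Path.Homotopic.Quotient.mk_surjective β
  rw [mapOfEq_mk, mapOfEq_mk] at h
  exact Path.Homotopic.Quotient.eq.2
    (homotopic_of_map_toTotal hq hp (Path.Homotopic.Quotient.eq.1 h))

/-! ### Lifting of loops and the image -/

/-- A loop in `P` lifts to a loop in the bundle induced by a covering `q : N → M` if and only if
its projection to `M` represents an element of `q_# π₁(N)`. -/
theorem range_mapOfEq_toTotal (hq : IsCoveringMap q) (hp : Continuous p) {y₀ : N} {x₀ : P}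
    (h₀ : q y₀ = p x₀) :
    (FundamentalGroup.mapOfEq (toTotal q p) rfl :
      FundamentalGroup (InducedBundle q p) ⟨(y₀, x₀), h₀⟩ →* FundamentalGroup P x₀).range =
    (FundamentalGroup.mapOfEq ⟨q, hq.continuous⟩ h₀).range.comap
      (FundamentalGroup.map ⟨p, hp⟩ x₀) := by
  ext β
  obtain ⟨γ, rfl⟩ := Path.Homotopic.Quotient.mk_surjective β
  rw [Subgroup.mem_comap]
  constructor
  · rintro ⟨α, hα⟩
    obtain ⟨δ, rfl⟩ := Path.Homotopic.Quotient.mk_surjective α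
    rw [← hα]
    have hfst : Continuous fun z : InducedBundle q p ↦ z.1.1 :=
      continuous_fst.comp continuous_subtype_val
    -- The preimage in `π₁(N)` is the class of the `N`-component of `δ`. Its image under `q`
    -- coincides with the `p`-image of the `P`-component pointwise, by the fibre product equation,
    -- so no homotopy is needed.
    refine ⟨Path.Homotopic.Quotient.mk (δ.map hfst), (mapOfEq_mk _ h₀ _).trans ?_⟩
    refine (congrArg Path.Homotopic.Quotient.mk (Path.ext (funext fun t ↦ (δ t).2))).trans
      (congrArg (FundamentalGroup.map ⟨p, hp⟩ x₀) (mapOfEq_mk (toTotal q p) rfl δ)).symm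
  · rintro ⟨α, hα⟩
    obtain ⟨δ, rfl⟩ := Path.Homotopic.Quotient.mk_surjective α
    rw [mapOfEq_mk] at hα
    -- Membership in the image of `q_#` becomes a homotopy from `q ∘ δ` to `p ∘ γ` relative to the
    -- endpoints, with `δ` a loop at `y₀`.
    have hhom := Path.Homotopic.Quotient.eq.1
      (hα : _ = Path.Homotopic.Quotient.mk (γ.map hp))
    have hs : (γ.map hp).toContinuousMap 0 = q y₀ := (γ.map hp).source.trans h₀.symm
    have hδ : ((δ.map hq.continuous).cast h₀.symm h₀.symm).toContinuousMap 0 = q y₀ :=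
      congrArg q δ.source
    -- The only candidate for the `N`-component of a lift of `γ`. A priori it is merely a path;
    -- `hΓ1` shows that it is closed.
    let Γ := hq.liftPath (γ.map hp).toContinuousMap y₀ hs
    have hΓ : ∀ t, q (Γ t) = p (γ t) := fun t ↦ congrFun (hq.liftPath_lifts _ y₀ hs) t
    -- By uniqueness, `δ` is the lift of its own projection. Lifts of homotopic paths from `y₀` have
    -- the same endpoint, so `Γ` ends where the loop `δ` ends.
    have hδlift : δ.toContinuousMap = hq.liftPath _ y₀ hδ :=
      (hq.eq_liftPath_iff' hδ).2 ⟨rfl, δ.source⟩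
    have hΓ1 : Γ 1 = y₀ := by
      rw [← hq.liftPath_apply_one_eq_of_homotopicRel hhom y₀ hδ hs, ← hδlift]
      exact δ.target
    refine ⟨Path.Homotopic.Quotient.mk
      { toFun := fun t ↦ ⟨(Γ t, γ t), hΓ t⟩
        continuous_toFun := (Γ.continuous.prodMk γ.continuous).subtype_mk _
        source' := Subtype.ext (Prod.ext (hq.liftPath_zero _ y₀ hs) γ.source)
        target' := Subtype.ext (Prod.ext hΓ1 γ.target) },
      mapOfEq_mk (toTotal q p) rfl _⟩

end FlatBundle.InducedBundle

/-! ### The isomorphism onto the preimage of the holonomy kernel -/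

theorem proposition2p3
    {EG EM EP : Type*}
    [NormedAddCommGroup EG] [NormedSpace ℝ EG] [FiniteDimensional ℝ EG]
    [NormedAddCommGroup EM] [NormedSpace ℝ EM] [FiniteDimensional ℝ EM]
    [NormedAddCommGroup EP] [NormedSpace ℝ EP] [FiniteDimensional ℝ EP]
    {G M P N : Type*}
    -- the Lie group `G`
    [Group G] [TopologicalSpace G] [ChartedSpace EG G] [LieGroup 𝓘(ℝ, EG) ∞ G]
    -- the connected paracompact smooth manifolds `M` and `P`
    [TopologicalSpace M] [ChartedSpace EM M] [IsManifold 𝓘(ℝ, EM) ∞ M]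
    [T2Space M] [ParacompactSpace M] [ConnectedSpace M]
    [TopologicalSpace P] [ChartedSpace EP P] [IsManifold 𝓘(ℝ, EP) ∞ P]
    [T2Space P] [ParacompactSpace P] [ConnectedSpace P]
    -- the principal bundle `P(M, G)` with a flat connection
    [MulAction G P] (p : P → M) (hp : IsSmoothPrincipalBundle EG EM EP G p)
    (θ : ConnectionForm EG EP G P) (hθ : θ.IsFlat EM p)
    -- the connected covering manifold `N` of `M`
    [TopologicalSpace N] [ChartedSpace EM N] [IsManifold 𝓘(ℝ, EM) ∞ N] [ConnectedSpace N]
    (q : N → M) (hq : IsSmoothCovering EM q)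
    -- base points `x₀` of `P` and `y₀` of `N` over the same point of `M`
    (x₀ : P) (y₀ : N) (h₀ : q y₀ = p x₀)
    -- the covering has fundamental group the kernel of the holonomy homomorphism
    (hker : (FundamentalGroup.mapOfEq ⟨q, hq.isCoveringMap.continuous⟩ h₀).range =
      (holonomyHom hp hθ x₀).ker) :
    ∃ e : FundamentalGroup (InducedBundle q p) ⟨(y₀, x₀), h₀⟩ ≃*
        (holonomyHom hp hθ x₀).ker.comap
          (FundamentalGroup.map ⟨p, hp.contMDiff_proj.continuous⟩ x₀),
      ∀ α, (e α : FundamentalGroup P x₀) =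
        FundamentalGroup.mapOfEq (InducedBundle.toTotal q p) rfl α := by

  let φ : FundamentalGroup (InducedBundle q p) ⟨(y₀, x₀), h₀⟩ →* FundamentalGroup P x₀ :=
    FundamentalGroup.mapOfEq (InducedBundle.toTotal q p) rfl
  have hrange : φ.range = (holonomyHom hp hθ x₀).ker.comap
      (FundamentalGroup.map ⟨p, hp.contMDiff_proj.continuous⟩ x₀) := by
    -- Holonomy is traded for covering theory: with its kernel replaced by `q_# π₁(N, y₀)`, the
    -- claim is the lifting criterion for loops.
    rw [← hker]
    exact InducedBundle.range_mapOfEq_toTotal hq.isCoveringMap hp.contMDiff_proj.continuous h₀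
  have hinj : Function.Injective φ :=
    InducedBundle.mapOfEq_toTotal_injective hq.isCoveringMap hp.contMDiff_proj.continuous _
  -- An injective homomorphism is an isomorphism onto its range. Transporting along `hrange` leaves
  -- the underlying elements unchanged, so the compatibility with `φ` is definitional.
  exact ⟨(MonoidHom.ofInjective hinj).trans (MulEquiv.subgroupCongr hrange), fun α ↦ rfl⟩
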